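/- Let $X$ be a finite topological space. For $p\in X$ let $U_p$ be the smallest open neighbourhood of $p$, and preorder $X$ by $p\le q \iff \overline{\{p\}}\subseteq\overline{\{q\}}$ (equivalently $U_q\subseteq U_p$). An *abelian data* on $X$ is a functor $F$ from the preorder $X$ to abelian groups, that is, abelian groups $F_p$ ($p\in X$) and homomorphisms $r_{pq}\colon F_p\to F_q$ for $p\le q$, with $r_{pp}=\mathrm{id}$ and $r_{qs}\circ r_{pq}=r_{ps}$. Let $C(X)$ be the category of (unbounded, cochain) complexes of abelian data on $X$, and $D(X)$ its derived category (the localization of $C(X)$ at quasi-isomorphisms); $D(\mathrm{Ab})$ is the derived category of abelian groups. An abelian data $\mathcal L$ on $X$ is *locally constant* if for every $p\in X$ the restriction $\mathcal L|_{U_p}$ is isomorphic to a constant abelian data on $U_p$; then all its maps $r_{pq}$ are isomorphisms. The *dual space* $\widehat X$ is the set $X$ (a point $p$ being denoted $\widehat p$) in which the open subsets are the closed subsets of $X$; thus $\widehat p\le\widehat q\iff q\le p$. A locally constant data $\mathcal L$ on $X$ is also viewed as a data on $\widehat X$ by $\mathcal L_{\widehat p}=\mathcal L_p$ and $r_{\widehat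 p\widehat q}=r_{qp}^{-1}$, and likewise for complexes. For complexes $K,K'$ let $\mathrm{Hom}^\bullet(K,K')$ be the total Hom complex of abelian groups, and let $P(K)\to K$ denote a functorial K-projective resolution. Let $$\mathbb R\mathrm{Hom}^\bullet(K,K')=\mathrm{Hom}^\bullet(P(K),K'),$$ the derived bifunctor $D(X)^{op}\times D(X)\to D(\mathrm{Ab})$ (and similarly on $\widehat X$). Let $\mathcal L$ be a complex of locally constant data on $X$ (hence also on $\widehat X$). For $F\in C(X)$ let $\mathcal D\mathrm{Hom}^\bullet(F,\mathcal L)\in C(\widehat X)$ be given by $$\mathcal D\mathrm{Hom}^\bullet(F,\mathcal L)_{\widehat p}=\mathrm{Hom}^\bullet(F_p,\mathcal L_p),$$ with transition maps, for $\widehat p\le\widehat q$, the composites $\mathrm{Hom}^\bullet(F_p,\mathcal L_p)\to\mathrm{Hom}^\bullet(F_q,\mathcal L_p)\cong\mathrm{Hom}^\bullet(F_q,\mathcal L_q)$ induced by $F_q\to F_p$ and by the isomorphism $\mathcal L_q\to\mathcal L_p$. For $T\in C(\widehat X)$ the complex $\mathcal D\mathrm{Hom}^\bullet(T,\mathcal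 L)\in C(X)$, $\mathcal D\mathrm{Hom}^\bullet(T,\mathcal L)_p=\mathrm{Hom}^\bullet(T_{\widehat p},\mathcal L_p)$, is defined in the same way (the dual of $\widehat X$ being $X$). Put $\mathbb L\mathcal D\mathrm{Hom}^\bullet(F,\mathcal L)=\mathcal D\mathrm{Hom}^\bullet(P(F),\mathcal L)$ and $\mathbb L\mathcal D\mathrm{Hom}^\bullet(T,\mathcal L)=\mathcal D\mathrm{Hom}^\bullet(P(T),\mathcal L)$; these define functors $D(X)^{op}\to D(\widehat X)$ and $D(\widehat X)^{op}\to D(X)$. **Theorem.** For every complex $\mathcal L$ of locally constant data on $X$ there are isomorphisms in $D(\mathrm{Ab})$ $$\mathbb R\mathrm{Hom}^\bullet\bigl(T,\mathbb L\mathcal D\mathrm{Hom}^\bullet(F,\mathcal L)\bigr)\;\cong\;\mathbb R\mathrm{Hom}^\bullet\bigl(F,\mathbb L\mathcal D\mathrm{Hom}^\bullet(T,\mathcal L)\bigr)$$ for all $F\in D(X)$ and $T\in D(\widehat X)$, natural in $F$ and in $T$. -/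

import Mathlib

universe u

open CategoryTheory Limits Opposite

namespace FiniteSpace

/-! ### Functorial K-projective resolutions -/

section KProjective

open HomologicalComplex CochainComplex ZeroObject

universe w' v' u'

variable {C : Type u'} [Category.{v'} C] [Abelian C]

lemma rel_succ (n : ℤ) : (ComplexShape.up ℤ).Rel n (n + 1) := by simp

/-- The inclusion of the complex `G` placed in degree `n + 1` into the complex
`G → G` (identity map) placed in degrees `n` and `n + 1`. -/
noncomputable def sphereToDisk (G : C) (n : ℤ) :
    (single C (ComplexShape.up ℤ) (n + 1)).obj G ⟶
      double (𝟙 G) (rel_succ n) :=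
  mkHomFromSingle (doubleXIso₁ (𝟙 G) _ (by lia)).inv
    (fun j _ ↦ by rw [double_d_eq_zero₀ _ _ _ _ (by lia), comp_zero])

/-- The generating cofibrations: `0 → Sⁿ(G)` and `Sⁿ⁺¹(G) → Dⁿ(G)` for all `n`. -/
def generatingCofibrations (G : C) : MorphismProperty (CochainComplex C ℤ) :=
  MorphismProperty.ofHoms
      (fun n : ℤ ↦ (0 : (0 : CochainComplex C ℤ) ⟶ (single C (ComplexShape.up ℤ) n).obj G)) ⊔
    MorphismProperty.ofHoms (sphereToDisk G)

lemma mono_sphereToDisk (G : C) (n : ℤ) : Mono (sphereToDisk G n) := by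
  apply +allowSynthFailures HomologicalComplex.mono_of_mono_f
  intro i
  by_cases hi : i = n + 1
  · subst hi
    dsimp only [sphereToDisk]
    rw [mkHomFromSingle_f]
    infer_instance
  · exact ⟨fun _ _ _ ↦ (isZero_single_obj_X _ _ _ _ hi).eq_of_tgt _ _⟩

lemma generatingCofibrations_le_monomorphisms (G : C) :
    generatingCofibrations G ≤ MorphismProperty.monomorphisms _ := by
  rintro _ _ _ (⟨⟨n⟩⟩ | ⟨⟨n⟩⟩)
  · exact ⟨fun _ _ _ ↦ (isZero_zero _).eq_of_tgt _ _⟩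
  · exact mono_sphereToDisk G n

lemma generatingCofibrations_hasSmallObjectArgument [IsGrothendieckAbelian.{w'} C] (G : C) :
    MorphismProperty.HasSmallObjectArgument.{w'} (generatingCofibrations G) := by
  let T : Option ℤ → CochainComplex C ℤ := fun o ↦
    o.elim 0 (fun n ↦ (single C (ComplexShape.up ℤ) (n + 1)).obj G)
  obtain ⟨κ, hκ', hκ⟩ := HasCardinalLT.exists_regular_cardinal_forall.{w'} (fun o ↦ Subobject (T o))
  have : Fact κ.IsRegular := ⟨hκ'⟩
  have : Nonempty κ.ord.ToType := by simpa using hκ'.ne_zero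
  have := WellFoundedLT.toOrderBot κ.ord.ToType
  have hsmall : MorphismProperty.IsSmall.{w'} (generatingCofibrations G) := by
    constructor
    rw [generatingCofibrations, MorphismProperty.toSet_max]
    infer_instance
  refine ⟨κ, inferInstance, inferInstance,
    { isSmall := hsmall
      preservesColimit {A B X Y} i hi f hf := ?_ }⟩
  let hf' : (MorphismProperty.monomorphisms
      (CochainComplex C ℤ)).TransfiniteCompositionOfShape κ.ord.ToType f :=
    { toTransfiniteCompositionOfShape := hf.toTransfiniteCompositionOfShape
      map_mem j hj := by
        have := (hf.attachCells j hj).pushouts_coproducts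
        simp only [MorphismProperty.ofHoms_homFamily] at this
        refine (?_ : _ ≤ MorphismProperty.monomorphisms _) _ this
        simp only [MorphismProperty.pushouts_le_iff, MorphismProperty.coproducts_le_iff]
        exact generatingCofibrations_le_monomorphisms G }
  have (j j' : κ.ord.ToType) (φ : j ⟶ j') : Mono (hf'.F.map φ) := hf'.mem_map φ
  apply IsGrothendieckAbelian.preservesColimit_coyoneda_obj_of_mono (Y := hf'.F) (κ := κ)
  rcases hi with ⟨⟨n⟩⟩ | ⟨⟨n⟩⟩
  · exact hκ none
  · exact hκ (some n)

lemma rlp_lift_cycle {G : C} {K L : CochainComplex C ℤ} {p : K ⟶ L}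
    (hp : (generatingCofibrations G).rlp p) (n : ℤ) (x : G ⟶ L.X n)
    (hx : x ≫ L.d n (n + 1) = 0) :
    ∃ y : G ⟶ K.X n, y ≫ K.d n (n + 1) = 0 ∧ y ≫ p.f n = x := by
  have := hp _ (show generatingCofibrations G _ from Or.inl ⟨n⟩)
  let b : (single C (ComplexShape.up ℤ) n).obj G ⟶ L := mkHomFromSingle x (by
    rintro j rfl; exact hx)
  have sq : CommSq 0 (0 : (0 : CochainComplex C ℤ) ⟶ _) p b := ⟨by simp⟩
  refine ⟨(singleObjXSelf (ComplexShape.up ℤ) n G).inv ≫ sq.lift.f n, ?_, ?_⟩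
  · rw [Category.assoc, sq.lift.comm]
    simp
  · rw [Category.assoc, ← HomologicalComplex.comp_f, sq.fac_right]
    simp [b]

/-- The morphism from a disk complex given by `b : G ⟶ L.X n`. -/
noncomputable def fromDisk {G : C} {L : CochainComplex C ℤ} (n : ℤ) (b : G ⟶ L.X n) :
    double (𝟙 G) (rel_succ n) ⟶ L :=
  mkHomFromDouble (rel_succ n) (by lia) b (b ≫ L.d n (n + 1)) (by simp) (by simp)

lemma disk_comm {G : C} {K : CochainComplex C ℤ} (n : ℤ) (φ : double (𝟙 G) (rel_succ n) ⟶ K) :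
    ((doubleXIso₀ (𝟙 G) (rel_succ n)).inv ≫ φ.f n) ≫ K.d n (n + 1) =
      (doubleXIso₁ (𝟙 G) (rel_succ n) (by lia)).inv ≫ φ.f (n + 1) := by
  rw [Category.assoc, φ.comm, double_d _ (rel_succ n) (show n ≠ n + 1 by lia)]
  simp

lemma rlp_lift_boundary {G : C} {K L : CochainComplex C ℤ} {p : K ⟶ L}
    (hp : (generatingCofibrations G).rlp p) (n : ℤ) (a : G ⟶ K.X (n + 1))
    (ha : a ≫ K.d (n + 1) (n + 1 + 1) = 0) (b : G ⟶ L.X n)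
    (hab : a ≫ p.f (n + 1) = b ≫ L.d n (n + 1)) :
    ∃ c : G ⟶ K.X n, c ≫ K.d n (n + 1) = a := by
  have := hp _ (show generatingCofibrations G _ from Or.inr ⟨n⟩)
  have hn : n ≠ n + 1 := by lia
  let t : (single C (ComplexShape.up ℤ) (n + 1)).obj G ⟶ K := mkHomFromSingle a (by
    rintro j rfl; exact ha)
  have sq : CommSq t (sphereToDisk G n) p (fromDisk n b) := ⟨by
    apply from_single_hom_ext
    rw [HomologicalComplex.comp_f, HomologicalComplex.comp_f]
    dsimp only [t, sphereToDisk, fromDisk]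
    rw [mkHomFromSingle_f, mkHomFromSingle_f, mkHomFromDouble_f₁]
    simp [hab]⟩
  refine ⟨_, (disk_comm n sq.lift).trans ?_⟩
  have h1 := congr_arg (fun φ ↦ (singleObjXSelf (ComplexShape.up ℤ) (n + 1) G).inv ≫ φ.f (n + 1))
    sq.fac_left
  dsimp only [t, sphereToDisk] at h1
  rw [HomologicalComplex.comp_f, mkHomFromSingle_f, mkHomFromSingle_f, Category.assoc,
    Iso.inv_hom_id_assoc, Iso.inv_hom_id_assoc] at h1
  exact h1

/-- Lifting criterion against the generating cofibrations. -/
lemma rlp_of_lifts {G : C} {K L : CochainComplex C ℤ} {p : K ⟶ L}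
    (h₁ : ∀ (n : ℤ) (x : G ⟶ L.X n), x ≫ L.d n (n + 1) = 0 →
      ∃ y : G ⟶ K.X n, y ≫ K.d n (n + 1) = 0 ∧ y ≫ p.f n = x)
    (h₂ : ∀ (n : ℤ) (a : G ⟶ K.X (n + 1)), a ≫ K.d (n + 1) (n + 1 + 1) = 0 →
      ∀ (b : G ⟶ L.X n), a ≫ p.f (n + 1) = b ≫ L.d n (n + 1) →
      ∃ c : G ⟶ K.X n, c ≫ K.d n (n + 1) = a ∧ c ≫ p.f n = b) :
    (generatingCofibrations G).rlp p := by
  rintro _ _ _ (⟨⟨n⟩⟩ | ⟨⟨n⟩⟩)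
  · refine ⟨fun {f g} sq ↦ ?_⟩
    obtain ⟨y, hy, hy'⟩ := h₁ n ((singleObjXSelf (ComplexShape.up ℤ) n G).inv ≫ g.f n) (by
      rw [Category.assoc, g.comm]; simp)
    refine ⟨⟨⟨mkHomFromSingle y (by rintro j rfl; exact hy),
      (isZero_zero _).eq_of_src _ _, ?_⟩⟩⟩
    apply from_single_hom_ext
    rw [HomologicalComplex.comp_f, mkHomFromSingle_f, Category.assoc, hy']
    simp
  · have hn : n ≠ n + 1 := by lia
    refine ⟨fun {f g} sq ↦ ?_⟩
    obtain ⟨c, hc, hc'⟩ := h₂ n ((singleObjXSelf (ComplexShape.up ℤ) (n + 1) G).inv ≫ f.f (n + 1))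
      (by rw [Category.assoc, f.comm]; simp)
      ((doubleXIso₀ (𝟙 G) (rel_succ n)).inv ≫ g.f n) (by
        have := congr_arg (fun φ ↦ (singleObjXSelf (ComplexShape.up ℤ) (n + 1) G).inv ≫
          φ.f (n + 1)) sq.w
        rw [HomologicalComplex.comp_f, HomologicalComplex.comp_f] at this
        dsimp only [sphereToDisk] at this
        rw [mkHomFromSingle_f] at this
        rw [disk_comm, Category.assoc, this]
        simp)
    refine ⟨⟨⟨fromDisk n c, ?_, ?_⟩⟩⟩
    · apply from_single_hom_ext
      rw [HomologicalComplex.comp_f]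
      dsimp only [sphereToDisk, fromDisk]
      rw [mkHomFromSingle_f, mkHomFromDouble_f₁, hc]
      simp
    · apply from_double_hom_ext
      · rw [HomologicalComplex.comp_f]
        dsimp only [fromDisk]
        rw [mkHomFromDouble_f₀, Category.assoc, hc']
        simp
      · rw [HomologicalComplex.comp_f]
        dsimp only [fromDisk]
        rw [mkHomFromDouble_f₁, Category.assoc, Category.assoc, ← p.comm, reassoc_of% hc', ← Category.assoc _ (g.f n),
          disk_comm]
        simp

lemma quasiIso_of_rlp [HasCoproducts.{v'} C] {G : C} (hG : IsSeparator G)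
    {K L : CochainComplex C ℤ} {p : K ⟶ L}
    (hp : (generatingCofibrations G).rlp p) : QuasiIso p where
  quasiIsoAt n := by
    obtain ⟨n, rfl⟩ : ∃ m, n = m + 1 := ⟨n - 1, by lia⟩
    rw [quasiIsoAt_iff_isIso_homologyMap]
    have hG' := (isSeparator_iff_epi G).1 hG
    have : Mono (homologyMap p (n + 1)) := by
      rw [mono_homologyMap_iff_up_to_refinements p n (n + 1) (n + 1 + 1) (by simp) (by simp)]
      intro A x hx y hy
      have H (g : G ⟶ A) := rlp_lift_boundary hp n (g ≫ x) (by simp [hx]) (g ≫ y) (by simp [hy])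
      choose c hc using H
      refine ⟨_, _, hG' A, Sigma.desc c, ?_⟩
      exact Sigma.hom_ext _ _ (fun g ↦ by simp [hc])
    have : Epi (homologyMap p (n + 1)) := by
      rw [epi_homologyMap_iff_up_to_refinements p n (n + 1) (n + 1 + 1) (by simp) (by simp)]
      intro A x hx
      have H (g : G ⟶ A) := rlp_lift_cycle hp (n + 1) (g ≫ x) (by simp [hx])
      choose c hc hc' using H
      refine ⟨_, _, hG' A, Sigma.desc c, ?_, 0, ?_⟩
      · exact Sigma.hom_ext _ _ (fun g ↦ by simp [hc])
      · exact Sigma.hom_ext _ _ (fun g ↦ by simp [hc'])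
    exact isIso_of_mono_of_epi _

lemma exists_lift_of_acyclic {G : C} [Projective G] {L : CochainComplex C ℤ} (hL : L.Acyclic)
    (n : ℤ) (x : G ⟶ L.X (n + 1)) (hx : x ≫ L.d (n + 1) (n + 1 + 1) = 0) :
    ∃ y : G ⟶ L.X n, y ≫ L.d n (n + 1) = x := by
  have h := hL (n + 1)
  rw [L.exactAt_iff' n (n + 1) (n + 1 + 1) (by simp) (by simp)] at h
  exact ⟨h.liftFromProjective x hx, h.liftFromProjective_comp x hx⟩

lemma mappingCocone_δ_snd {K L : CochainComplex C ℤ} (φ : K ⟶ L) :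
    HomComplex.δ (-1) 0 (mappingCocone.snd φ) =
      -HomComplex.Cochain.ofHom (mappingCocone.fst φ ≫ φ) := by
  have h : mappingCocone.snd φ = mappingCocone.descCochain φ (0 : HomComplex.Cochain K L (-1))
      (HomComplex.Cochain.ofHom (𝟙 L)) (by lia) := by
    ext p q hpq
    rw [← Category.id_comp ((mappingCocone.snd φ).v p q hpq),
      ← Category.id_comp ((mappingCocone.descCochain φ _ _ _).v p q hpq),
      ← mappingCocone.id_X φ p q hpq, Preadditive.add_comp, Preadditive.add_comp]
    simp
  rw [h, mappingCocone.δ_descCochain φ _ _ _ 1 (by lia)]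
  simp [HomComplex.Cochain.ofHom_comp]

lemma mappingCocone_d_snd {K L : CochainComplex C ℤ} (φ : K ⟶ L) (n : ℤ) :
    (mappingCocone φ).d (n + 1) (n + 1 + 1) ≫ (mappingCocone.snd φ).v (n + 1 + 1) (n + 1) (by lia) =
      -(mappingCocone.fst φ).f (n + 1) ≫ φ.f (n + 1)
        -(mappingCocone.snd φ).v (n + 1) n (by lia) ≫ L.d n (n + 1) := by
  have := HomComplex.Cochain.congr_v (mappingCocone_δ_snd φ) (n + 1) (n + 1) (by lia)
  rw [HomComplex.δ_v (-1) 0 (by lia) _ _ _ _ n (n + 1 + 1) (by lia) (by lia)] at this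
  simp at this
  rw [eq_sub_iff_add_eq]
  exact (add_comm _ _).trans this

lemma mappingCocone_ext_to {K L : CochainComplex C ℤ} (φ : K ⟶ L) (n : ℤ) {A : C}
    {f g : A ⟶ (mappingCocone φ).X (n + 1)}
    (h₁ : f ≫ (mappingCocone.fst φ).f (n + 1) = g ≫ (mappingCocone.fst φ).f (n + 1))
    (h₂ : f ≫ (mappingCocone.snd φ).v (n + 1) n (by lia) =
      g ≫ (mappingCocone.snd φ).v (n + 1) n (by lia)) : f = g := by
  rw [← Category.comp_id f, ← Category.comp_id g,
    ← mappingCocone.id_X φ (n + 1) n (by lia)]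
  simp [reassoc_of% h₁, reassoc_of% h₂]

lemma mappingCocone_fst_rlp {G : C} [Projective G] {L : CochainComplex C ℤ} (hL : L.Acyclic) :
    (generatingCofibrations G).rlp (mappingCocone.fst (𝟙 L)) := by
  apply rlp_of_lifts
  · intro n x hx
    obtain ⟨n, rfl⟩ : ∃ m, n = m + 1 := ⟨n - 1, by lia⟩
    obtain ⟨w, hw⟩ := exists_lift_of_acyclic hL n x hx
    refine ⟨x ≫ (mappingCocone.inl (𝟙 L)).v (n + 1) (n + 1) (by lia) -
      w ≫ (mappingCocone.inr (𝟙 L)).1.v n (n + 1) (by lia), ?_, by simp⟩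
    apply mappingCocone_ext_to
    · rw [Category.assoc, ← (mappingCocone.fst (𝟙 L)).comm]
      simp [hx, -HomologicalComplex.Hom.comm]
    · rw [Category.assoc, mappingCocone_d_snd]
      simp [hw]
  · intro n a ha b hab
    obtain ⟨n, rfl⟩ : ∃ m, n = m + 1 := ⟨n - 1, by lia⟩
    have h := a ≫= mappingCocone_d_snd (𝟙 L) (n + 1)
    rw [reassoc_of% ha] at h
    obtain ⟨w, hw⟩ := exists_lift_of_acyclic hL n
      (b + a ≫ (mappingCocone.snd (𝟙 L)).v (n + 1 + 1) (n + 1) (by lia)) (by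
        simp [hab] at h
        rw [Preadditive.add_comp, Category.assoc, ← neg_eq_zero, neg_add, ← sub_eq_add_neg]
        exact h.symm)
    refine ⟨b ≫ (mappingCocone.inl (𝟙 L)).v (n + 1) (n + 1) (by lia) -
      w ≫ (mappingCocone.inr (𝟙 L)).1.v n (n + 1) (by lia), ?_, by simp⟩
    apply mappingCocone_ext_to
    · rw [Category.assoc, ← (mappingCocone.fst (𝟙 L)).comm]
      simp [hab, -HomologicalComplex.Hom.comm]
    · rw [Category.assoc, mappingCocone_d_snd]
      simp [hw]

lemma isKProjective_of_llp {G : C} [Projective G] {P : CochainComplex C ℤ}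
    (hP : (generatingCofibrations G).rlp.llp (0 : (0 : CochainComplex C ℤ) ⟶ P)) :
    P.IsKProjective where
  nonempty_homotopy_zero {L} f hL := by
    have := hP _ (mappingCocone_fst_rlp (G := G) hL)
    have sq : CommSq 0 (0 : (0 : CochainComplex C ℤ) ⟶ P) (mappingCocone.fst (𝟙 L)) f :=
      ⟨by simp⟩
    refine ⟨(HomComplex.Cochain.equivHomotopy _ _).symm
      ⟨-(HomComplex.Cochain.ofHom sq.lift).comp (mappingCocone.snd (𝟙 L)) (zero_add _), ?_⟩⟩
    rw [HomComplex.δ_neg, HomComplex.δ_ofHom_comp, mappingCocone_δ_snd]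
    rw [HomComplex.Cochain.ofHom_zero, add_zero]
    refine (congrArg HomComplex.Cochain.ofHom sq.fac_right).symm.trans ?_
    ext p
    simp only [HomComplex.Cochain.ofHom_v, Category.comp_id, HomComplex.Cochain.ofHom_comp,
      HomComplex.Cochain.zero_cochain_comp_v, HomComplex.Cochain.comp_neg, neg_neg]

/-- A Grothendieck abelian category with a projective separator has functorial
K-projective resolutions. -/
theorem exists_functorial_kProjective_resolution [IsGrothendieckAbelian.{v'} C]
    {G : C} [Projective G] (hG : IsSeparator G) :
    ∃ (P : CochainComplex C ℤ ⥤ CochainComplex C ℤ) (π : P ⟶ 𝟭 _),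
      ∀ K, (P.obj K).IsKProjective ∧ QuasiIso (π.app K) := by
  have := generatingCofibrations_hasSmallObjectArgument.{v'} G
  let data := MorphismProperty.functorialFactorizationData
    (generatingCofibrations G).rlp.llp (generatingCofibrations G).rlp
  let A : CochainComplex C ℤ ⥤ Arrow (CochainComplex C ℤ) :=
    { obj K := Arrow.mk (0 : (0 : CochainComplex C ℤ) ⟶ K)
      map f := Arrow.homMk (𝟙 _) f (by simp) }
  refine ⟨A ⋙ data.Z, { app K := data.p.app (A.obj K), naturality K L f := ?_ }, fun K ↦ ⟨?_, ?_⟩⟩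
  · exact data.p.naturality (A.map f)
  · have h := data.hi (A.obj K)
    have : data.i.app (A.obj K) = 0 := (isZero_zero _).eq_of_src _ _
    rw [this] at h
    exact isKProjective_of_llp h
  · exact quasiIso_of_rlp hG (data.hp (A.obj K))

end KProjective

section FreeData

variable {A : Type u} [Category.{u} A]

/-- The functor `q ↦ ℤ[Hom(p, q)]`. -/
noncomputable abbrev freeData (p : A) : A ⥤ AddCommGrpCat.{u} :=
  coyoneda.obj (op p) ⋙ AddCommGrpCat.free

noncomputable def freeDataHomEquiv (p : A) (F : A ⥤ AddCommGrpCat.{u}) :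
    (freeData p ⟶ F) ≃ F.obj p :=
  ((AddCommGrpCat.adj.whiskerRight A).homEquiv (coyoneda.obj (op p)) F).trans coyonedaEquiv

lemma freeDataHomEquiv_comp (p : A) {F G : A ⥤ AddCommGrpCat.{u}} (f : freeData p ⟶ F)
    (g : F ⟶ G) : freeDataHomEquiv p G (f ≫ g) = g.app p (freeDataHomEquiv p F f) := by
  exact congrArg coyonedaEquiv
    ((AddCommGrpCat.adj.whiskerRight A).homEquiv_naturality_right f g)

instance (p : A) : Projective (freeData p) where
  factors {E F} f e he := by
    have : Epi (e.app p) := inferInstance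
    rw [AddCommGrpCat.epi_iff_surjective] at this
    obtain ⟨y, hy⟩ := this (freeDataHomEquiv p _ f)
    refine ⟨(freeDataHomEquiv p _).symm y, ?_⟩
    apply (freeDataHomEquiv p _).injective
    rw [freeDataHomEquiv_comp, Equiv.apply_symm_apply, hy]

/-- The direct sum of all `freeData p` is a projective separator. -/
noncomputable def generator (A : Type u) [Category.{u} A] : A ⥤ AddCommGrpCat.{u} :=
  ∐ (freeData : A → A ⥤ AddCommGrpCat.{u})

instance : Projective (generator A) := by dsimp [generator]; infer_instance

lemma generator_isSeparator : IsSeparator (generator A) := by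
  classical
  rw [isSeparator_def]
  intro F G f g h
  ext p x
  let i : freeData p ⟶ F := (freeDataHomEquiv p F).symm x
  let k (q : A) : freeData q ⟶ F :=
    if hq : q = p then eqToHom (congrArg freeData hq) ≫ i else (0 : freeData q ⟶ F)
  have h' : Limits.Sigma.desc k ≫ f = Limits.Sigma.desc k ≫ g := h (Limits.Sigma.desc k)
  have h'' := Limits.Sigma.ι (freeData : A → A ⥤ AddCommGrpCat.{u}) p ≫= h'
  have hk : k p = i := by simp [k]
  rw [Limits.Sigma.ι_desc_assoc, Limits.Sigma.ι_desc_assoc, hk] at h''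
  have h3 := congr_arg (freeDataHomEquiv p G) h''
  rw [freeDataHomEquiv_comp, freeDataHomEquiv_comp] at h3
  simpa [i] using h3

instance : IsGrothendieckAbelian.{u} (A ⥤ AddCommGrpCat.{u}) where
  ab5OfSize := { ofShape := fun _ _ _ ↦ inferInstance }
  hasSeparator := ⟨_, generator_isSeparator⟩

end FreeData

/-! ### Complexes of homomorphisms -/

section HomComplex

open CochainComplex

universe v' u'

variable {C : Type u'} [Category.{v'} C] [Preadditive C]

/-- The morphism of complexes `Hom•(K', L) ⟶ Hom•(K, L')`, `α ↦ g ∘ α ∘ f`, induced by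
morphisms of complexes `f : K ⟶ K'` and `g : L ⟶ L'`. -/
def homComplexMap {K K' L L' : CochainComplex C ℤ} (f : K ⟶ K') (g : L ⟶ L') :
    HomComplex K' L ⟶ HomComplex K L' where
  f n := AddCommGrpCat.ofHom
    { toFun := fun α : HomComplex.Cochain K' L n ↦
        ((HomComplex.Cochain.ofHom f).comp (α.comp (HomComplex.Cochain.ofHom g) (add_zero n))
          (zero_add n) : HomComplex.Cochain K L' n)
      map_zero' := by simp
      map_add' α β := by simp }
  comm' i j _ := by
    ext α
    exact (HomComplex.δ_ofHom_comp f _ j).trans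
      (congrArg (fun z : HomComplex.Cochain K' L' j ↦
        (HomComplex.Cochain.ofHom f).comp z (zero_add j)) (HomComplex.δ_comp_ofHom _ g j))

lemma homComplexMap_apply {K K' L L' : CochainComplex C ℤ} (f : K ⟶ K') (g : L ⟶ L') (n : ℤ)
    (α : HomComplex.Cochain K' L n) :
    (homComplexMap f g).f n α = ((HomComplex.Cochain.ofHom f).comp
      (α.comp (HomComplex.Cochain.ofHom g) (add_zero n)) (zero_add n) :
        HomComplex.Cochain K L' n) := rfl

lemma homComplexMap_id (K L : CochainComplex C ℤ) :
    homComplexMap (𝟙 K) (𝟙 L) = 𝟙 (HomComplex K L) := by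
  ext n α
  have h (α : HomComplex.Cochain K L n) : (HomComplex.Cochain.ofHom (𝟙 K)).comp
      (α.comp (HomComplex.Cochain.ofHom (𝟙 L)) (add_zero n)) (zero_add n) = α := by simp
  exact h α

lemma homComplexMap_comp {K K' K'' L L' L'' : CochainComplex C ℤ} (f : K ⟶ K') (f' : K' ⟶ K'')
    (g : L ⟶ L') (g' : L' ⟶ L'') :
    homComplexMap (f ≫ f') (g ≫ g') = homComplexMap f' g ≫ homComplexMap f g' := by
  ext n α
  have h (α : HomComplex.Cochain K'' L n) : (HomComplex.Cochain.ofHom (f ≫ f')).comp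
      (α.comp (HomComplex.Cochain.ofHom (g ≫ g')) (add_zero n)) (zero_add n) =
    (HomComplex.Cochain.ofHom f).comp (((HomComplex.Cochain.ofHom f').comp
      (α.comp (HomComplex.Cochain.ofHom g) (add_zero n)) (zero_add n)).comp
        (HomComplex.Cochain.ofHom g') (add_zero n)) (zero_add n) := by
    ext p q hpq
    simp
  exact h α

/-- The bifunctor `Hom•(-, -)`. -/
def homComplexFunctor (C : Type u') [Category.{v'} C] [Preadditive C] :
    (CochainComplex C ℤ)ᵒᵖ ⥤ CochainComplex C ℤ ⥤ CochainComplex AddCommGrpCat.{v'} ℤ where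
  obj K :=
    { obj L := HomComplex K.unop L
      map g := homComplexMap (𝟙 _) g
      map_id L := homComplexMap_id _ _
      map_comp g g' := by rw [← homComplexMap_comp, Category.id_comp] }
  map f :=
    { app L := homComplexMap f.unop (𝟙 L)
      naturality L L' g := by
        dsimp
        rw [← homComplexMap_comp, ← homComplexMap_comp]
        simp }
  map_id K := by ext L : 2; exact homComplexMap_id _ _
  map_comp f f' := by
    ext L : 2
    dsimp
    rw [← homComplexMap_comp, Category.id_comp]

lemma leftHomology_commf {D : Type*} [Category* D] [HasZeroMorphisms D] {S₁ S₂ : ShortComplex D}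
    (φ : S₁ ⟶ S₂) {h₁ : S₁.LeftHomologyData} {h₂ : S₂.LeftHomologyData} (φK : h₁.K ⟶ h₂.K)
    (hi : φK ≫ h₂.i = h₁.i ≫ φ.τ₂) : h₁.f' ≫ φK = φ.τ₁ ≫ h₂.f' := by
  rw [← cancel_mono h₂.i]
  simp [hi, φ.comm₁₂]

lemma quasiIso_homComplexMap {K K' L L' : CochainComplex C ℤ} (f : K ⟶ K') (g : L ⟶ L')
    (H : ∀ (n : ℤ), Function.Bijective
      (fun x : (HomotopyCategory.quotient C _).obj K' ⟶
          (HomotopyCategory.quotient C _).obj (L⟦n⟧) ↦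
        (HomotopyCategory.quotient C (.up ℤ)).map f ≫ x ≫
          (HomotopyCategory.quotient C (.up ℤ)).map (g⟦n⟧'))) :
    QuasiIso (homComplexMap f g) where
  quasiIsoAt n := by
    rw [quasiIsoAt_iff]
    let c : HomComplex.CohomologyClass K' L n →+ HomComplex.CohomologyClass K L' n :=
      HomComplex.CohomologyClass.descAddMonoidHom
        (AddMonoidHom.mk' (fun z ↦ HomComplex.CohomologyClass.mk ((z.postcomp g).precomp f)) (by
            intro z z'
            rw [← HomComplex.CohomologyClass.mk_add]
            congr 1
            ext : 1
            simp))
        (by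
          rintro _ ⟨m, hm, β, hβ⟩
          rw [AddMonoidHom.mem_ker, AddMonoidHom.mk'_apply,
            HomComplex.CohomologyClass.mk_eq_zero_iff]
          refine ⟨m, hm, (homComplexMap f g).f m β, ?_⟩
          rw [homComplexMap_apply, HomComplex.δ_ofHom_comp, HomComplex.δ_comp_ofHom, hβ]
          rfl)
    let k : (HomComplex.leftHomologyData K' L n).K ⟶ (HomComplex.leftHomologyData K L' n).K :=
      AddCommGrpCat.ofHom (AddMonoidHom.mk' (fun z ↦ (z.postcomp g).precomp f) (by
            intro z z'
            ext : 1
            simp))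
    let γ : ShortComplex.LeftHomologyMapData
        ((HomologicalComplex.shortComplexFunctor _ _ n).map (homComplexMap f g))
        (HomComplex.leftHomologyData K' L n) (HomComplex.leftHomologyData K L' n) :=
      { φK := k
        φH := AddCommGrpCat.ofHom c
        commi := rfl
        commf' := leftHomology_commf
          ((HomologicalComplex.shortComplexFunctor _ _ n).map (homComplexMap f g)) k rfl
        commπ := rfl }
    rw [γ.quasiIso_iff, ConcreteCategory.isIso_iff_bijective]
    have h (x : HomComplex.CohomologyClass K' L n) :
        HomComplex.CohomologyClass.toHom (c x) =
          (HomotopyCategory.quotient C (.up ℤ)).map f ≫ HomComplex.CohomologyClass.toHom x ≫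
          (HomotopyCategory.quotient C (.up ℤ)).map (g⟦n⟧') := by
      obtain ⟨x, rfl⟩ := x.mk_surjective
      have hc : c (HomComplex.CohomologyClass.mk x) =
        HomComplex.CohomologyClass.mk ((x.postcomp g).precomp f) := rfl
      rw [hc, HomComplex.CohomologyClass.toHom_mk, HomComplex.CohomologyClass.toHom_mk,
        HomComplex.Cocycle.equivHomShift_symm_precomp,
        HomComplex.Cocycle.equivHomShift_symm_postcomp, Functor.map_comp, Functor.map_comp]
    have h' := (H n).comp (HomComplex.CohomologyClass.toHom_bijective K' L n)
    have h'' : Function.Bijective (HomComplex.CohomologyClass.toHom ∘ c) := by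
      convert h' using 1
      ext x
      exact h x
    exact (Function.Bijective.of_comp_iff'
      (HomComplex.CohomologyClass.toHom_bijective K L' n) c).1 h''

end HomComplex

/-! ### The derived functor of `Hom•` -/

section HomComplex

universe v' u'

variable {C : Type u'} [Category.{v'} C]

lemma quasiIso_homComplexMap_of_isIso [Preadditive C] {K K' : CochainComplex C ℤ} (f : K ⟶ K')
    [hf : IsIso ((HomotopyCategory.quotient C (.up ℤ)).map f)] (L : CochainComplex C ℤ) :
    QuasiIso (homComplexMap f (𝟙 L)) := by
  refine quasiIso_homComplexMap f (𝟙 L) (fun n ↦ ?_)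
  have e : (HomotopyCategory.quotient C (.up ℤ)).map ((𝟙 L)⟦n⟧') = 𝟙 _ := by
    refine (congrArg _ ((shiftFunctor (CochainComplex C ℤ) n).map_id L)).trans ?_
    exact (HomotopyCategory.quotient C (.up ℤ)).map_id _
  refine ⟨fun x y h ↦ ?_, fun y ↦ ⟨inv ((HomotopyCategory.quotient C (.up ℤ)).map f) ≫ y, ?_⟩⟩
  · rw [e] at h
    simpa using! (cancel_epi _).1 h
  · rw [e]
    simp

variable [Abelian C]

lemma isIso_quotient_map_of_quasiIso {K K' : CochainComplex C ℤ} (f : K ⟶ K') [QuasiIso f]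
    [K.IsKProjective] [K'.IsKProjective] :
    IsIso ((HomotopyCategory.quotient C (.up ℤ)).map f) := by
  have h := (CochainComplex.IsKProjective.quasiIso_iff f).1 inferInstance
  rwa [← HomotopyCategory.inverseImage_quotient_isomorphisms, MorphismProperty.inverseImage_iff,
    MorphismProperty.isomorphisms.iff] at h

lemma quasiIso_homComplexMap_of_isKProjective (K : CochainComplex C ℤ) [K.IsKProjective]
    {L L' : CochainComplex C ℤ} (g : L ⟶ L') [QuasiIso g] :
    QuasiIso (homComplexMap (𝟙 K) g) := by
  let _ : HasDerivedCategory C := HasDerivedCategory.standard C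
  refine quasiIso_homComplexMap (𝟙 K) g (fun n ↦ ?_)
  let q := HomotopyCategory.quotient C (.up ℤ)
  have hg : IsIso (DerivedCategory.Qh.map (q.map (g⟦n⟧'))) := by
    have : QuasiIso (g⟦n⟧') := inferInstance
    exact (NatIso.isIso_map_iff (DerivedCategory.quotientCompQhIso C) _).2 inferInstance
  refine (Function.Bijective.of_comp_iff'
    (CochainComplex.IsKProjective.Qh_map_bijective K (q.obj (L'⟦n⟧))) _).1 ?_
  have h : Function.Bijective
      (fun x ↦ x ≫ DerivedCategory.Qh.map (q.map (g⟦n⟧')) :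
        (DerivedCategory.Qh.obj (q.obj K) ⟶ DerivedCategory.Qh.obj (q.obj (L⟦n⟧))) → _) :=
    ⟨fun x y h ↦ (cancel_mono _).1 h, fun y ↦ ⟨y ≫ inv (DerivedCategory.Qh.map (q.map (g⟦n⟧'))),
      by simp⟩⟩
  convert h.comp (CochainComplex.IsKProjective.Qh_map_bijective K (q.obj (L⟦n⟧))) using 1
  ext x
  dsimp only [Function.comp_apply]
  rw [CategoryTheory.Functor.map_id, Category.id_comp, Functor.map_comp]

end HomComplex

section DerivedHom

variable (A : Type u) [Category.{u} A]

noncomputable instance : HasDerivedCategory.{u + 1} (A ⥤ AddCommGrpCat.{u}) :=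
  HasDerivedCategory.standard _

noncomputable instance : HasDerivedCategory.{u + 1} AddCommGrpCat.{u} :=
  HasDerivedCategory.standard _

/-- A functorial K-projective resolution `P(F) → F`. -/
noncomputable def kProjectiveResolution :
    CochainComplex (A ⥤ AddCommGrpCat.{u}) ℤ ⥤ CochainComplex (A ⥤ AddCommGrpCat.{u}) ℤ :=
  (exists_functorial_kProjective_resolution (generator_isSeparator (A := A))).choose

noncomputable def kProjectiveResolutionπ : kProjectiveResolution A ⟶ 𝟭 _ :=
  (exists_functorial_kProjective_resolution (generator_isSeparator (A := A))).choose_spec.choose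

variable {A}

instance (F : CochainComplex (A ⥤ AddCommGrpCat.{u}) ℤ) :
    ((kProjectiveResolution A).obj F).IsKProjective :=
  ((exists_functorial_kProjective_resolution
    (generator_isSeparator (A := A))).choose_spec.choose_spec F).1

instance (F : CochainComplex (A ⥤ AddCommGrpCat.{u}) ℤ) :
    QuasiIso ((kProjectiveResolutionπ A).app F) :=
  ((exists_functorial_kProjective_resolution
    (generator_isSeparator (A := A))).choose_spec.choose_spec F).2

instance {F F' : CochainComplex (A ⥤ AddCommGrpCat.{u}) ℤ} (f : F ⟶ F') [QuasiIso f] :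
    QuasiIso ((kProjectiveResolution A).map f) := by
  have h := (kProjectiveResolutionπ A).naturality f
  have : QuasiIso ((kProjectiveResolution A).map f ≫ (kProjectiveResolutionπ A).app F') := by
    rw [h]
    dsimp
    infer_instance
  exact quasiIso_of_comp_right _ ((kProjectiveResolutionπ A).app F')

instance {F F' : CochainComplex (A ⥤ AddCommGrpCat.{u}) ℤ} (f : F ⟶ F') [QuasiIso f] :
    IsIso ((HomotopyCategory.quotient _ (.up ℤ)).map ((kProjectiveResolution A).map f)) :=
  isIso_quotient_map_of_quasiIso _

variable (A) in
/-- The bifunctor `(F, G) ↦ Hom•(P(F), G)`, with values in the derived category of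
abelian groups. -/
noncomputable def preRHom :
    (CochainComplex (A ⥤ AddCommGrpCat.{u}) ℤ)ᵒᵖ ⥤ CochainComplex (A ⥤ AddCommGrpCat.{u}) ℤ ⥤
      DerivedCategory AddCommGrpCat.{u} :=
  (kProjectiveResolution A).op ⋙ homComplexFunctor (A ⥤ AddCommGrpCat.{u}) ⋙
    (Functor.whiskeringRight _ _ _).obj DerivedCategory.Q

lemma preRHom_isInvertedBy :
    MorphismProperty.IsInvertedBy₂
      (HomologicalComplex.quasiIso (A ⥤ AddCommGrpCat.{u}) (.up ℤ)).op
      (HomologicalComplex.quasiIso (A ⥤ AddCommGrpCat.{u}) (.up ℤ)) (preRHom A) := by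
  rintro ⟨F, G⟩ ⟨F', G'⟩ ⟨f, g⟩ ⟨hf, hg⟩
  have hf' : QuasiIso f.unop := hf
  have hg' : QuasiIso g := hg
  have h₁ : QuasiIso (homComplexMap ((kProjectiveResolution A).map f.unop) (𝟙 G)) :=
    quasiIso_homComplexMap_of_isIso _ _
  have h₂ : QuasiIso (homComplexMap (𝟙 ((kProjectiveResolution A).obj F'.unop)) g) :=
    quasiIso_homComplexMap_of_isKProjective _ _
  have h₃ : IsIso (DerivedCategory.Q.map
    (homComplexMap ((kProjectiveResolution A).map f.unop) (𝟙 G)) ≫ DerivedCategory.Q.map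
    (homComplexMap (𝟙 ((kProjectiveResolution A).obj F'.unop)) g)) := inferInstance
  exact h₃

variable (A) in
/-- The derived functor `RHom : D(A)ᵒᵖ × D(A) ⥤ D(Ab)`, induced by `(F, G) ↦ Hom•(P(F), G)`. -/
noncomputable def RHom : (DerivedCategory (A ⥤ AddCommGrpCat.{u}))ᵒᵖ ⥤
    DerivedCategory (A ⥤ AddCommGrpCat.{u}) ⥤ DerivedCategory AddCommGrpCat.{u} :=
  Localization.lift₂ (preRHom A) preRHom_isInvertedBy DerivedCategory.Q.op DerivedCategory.Q

end DerivedHom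

/-! ### Pointwise complexes of homomorphisms -/

section PointwiseHom

variable {A B : Type u} [Category.{u} A] [Category.{u} B]

/-- A functor `B ⥤ C(Ab)`, considered as a complex of functors `B ⥤ Ab`. -/
def complexOfFunctor :
    (B ⥤ CochainComplex AddCommGrpCat.{u} ℤ) ⥤ CochainComplex (B ⥤ AddCommGrpCat.{u}) ℤ where
  obj Φ :=
    { X n := Φ ⋙ HomologicalComplex.eval _ _ n
      d i j := { app b := (Φ.obj b).d i j, naturality b b' g := (Φ.map g).comm i j }
      shape i j h := by ext b : 2; exact (Φ.obj b).shape i j h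
      d_comp_d' i j k _ _ := by ext b : 2; exact (Φ.obj b).d_comp_d i j k }
  map τ :=
    { f n := Functor.whiskerRight τ _
      comm' i j _ := by ext b : 2; exact (τ.app b).comm i j }

lemma quasiIso_complexOfFunctor_map {Φ Ψ : B ⥤ CochainComplex AddCommGrpCat.{u} ℤ} (τ : Φ ⟶ Ψ)
    (h : ∀ b, QuasiIso (τ.app b)) : QuasiIso (complexOfFunctor.map τ) := by
  rw [HomologicalComplex.quasiIso_iff_evaluation]
  exact h

variable (A) in
/-- A complex `F` of functors, considered as the functor `a ↦ F_a` to complexes of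
abelian groups. -/
abbrev values : CochainComplex (A ⥤ AddCommGrpCat.{u}) ℤ ⥤ A ⥤ CochainComplex AddCommGrpCat.{u} ℤ :=
  HomologicalComplex.complexOfFunctorsToFunctorToComplex

/-- Given a complex `F` of functors on `A`, a complex `M` of functors on `B` and a contravariant
functor `φ` from `B` to `A`, this is the complex of functors `b ↦ Hom•(F_{φ b}, M_b)` on `B`.
For `g : b ⟶ b'`, the transition map is
`Hom•(F_{φ b}, M_b) ⟶ Hom•(F_{φ b'}, M_b')`, `α ↦ M_g ∘ α ∘ F_{φ g}`. -/
noncomputable def pointwiseHom (φ : B ⥤ Aᵒᵖ) (M : CochainComplex (B ⥤ AddCommGrpCat.{u}) ℤ) :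
    (CochainComplex (A ⥤ AddCommGrpCat.{u}) ℤ)ᵒᵖ ⥤ CochainComplex (B ⥤ AddCommGrpCat.{u}) ℤ where
  obj F := complexOfFunctor.obj
    { obj b := CochainComplex.HomComplex (((values A).obj F.unop).obj (φ.obj b).unop)
        (((values B).obj M).obj b)
      map g := homComplexMap (((values A).obj F.unop).map (φ.map g).unop)
        (((values B).obj M).map g)
      map_id b := by
        rw [φ.map_id, unop_id, CategoryTheory.Functor.map_id, CategoryTheory.Functor.map_id]
        exact homComplexMap_id _ _
      map_comp g g' := by
        rw [φ.map_comp, unop_comp, Functor.map_comp, Functor.map_comp]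
        exact homComplexMap_comp _ _ _ _ }
  map f := complexOfFunctor.map
    { app b := homComplexMap (((values A).map f.unop).app (φ.obj b).unop)
        (𝟙 (((values B).obj M).obj b))
      naturality b b' g := by
        refine (homComplexMap_comp _ _ _ _).symm.trans
          (Eq.trans ?_ (homComplexMap_comp _ _ _ _))
        rw [Category.id_comp, Category.comp_id]
        congr 1
        exact (((values A).map f.unop).naturality _).symm }
  map_id F := by
    refine (congrArg complexOfFunctor.map ?_).trans (complexOfFunctor.map_id _)
    ext b : 2
    exact homComplexMap_id _ _
  map_comp f f' := by
    refine Eq.trans (congrArg complexOfFunctor.map ?_) (complexOfFunctor.map_comp _ _)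
    ext b : 2
    refine Eq.trans ?_ (homComplexMap_comp _ _ _ _)
    rw [Category.id_comp]
    rfl

lemma quasiIso_pointwiseHom_map (φ : B ⥤ Aᵒᵖ) (M : CochainComplex (B ⥤ AddCommGrpCat.{u}) ℤ)
    {F F' : CochainComplex (A ⥤ AddCommGrpCat.{u}) ℤ} (f : F ⟶ F')
    [hf : IsIso ((HomotopyCategory.quotient _ (.up ℤ)).map f)] :
    QuasiIso ((pointwiseHom φ M).map f.op) := by
  refine quasiIso_complexOfFunctor_map _ (fun b ↦ ?_)
  have h : IsIso ((HomotopyCategory.quotient _ (.up ℤ)).map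
      (((values A).map f).app (φ.obj b).unop)) :=
    inferInstanceAs (IsIso ((((evaluation A AddCommGrpCat.{u}).obj
      (φ.obj b).unop).mapHomotopyCategory _).map
        ((HomotopyCategory.quotient _ (.up ℤ)).map f)))
  exact quasiIso_homComplexMap_of_isIso (hf := h) _ _

/-- The functor `F ↦ (b ↦ Hom•(P(F)_{φ b}, M_b))`, with values in the derived category. -/
noncomputable def preLPointwiseHom (φ : B ⥤ Aᵒᵖ) (M : CochainComplex (B ⥤ AddCommGrpCat.{u}) ℤ) :
    (CochainComplex (A ⥤ AddCommGrpCat.{u}) ℤ)ᵒᵖ ⥤ DerivedCategory (B ⥤ AddCommGrpCat.{u}) :=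
  (kProjectiveResolution A).op ⋙ pointwiseHom φ M ⋙ DerivedCategory.Q

lemma preLPointwiseHom_isInvertedBy (φ : B ⥤ Aᵒᵖ)
    (M : CochainComplex (B ⥤ AddCommGrpCat.{u}) ℤ) :
    (HomologicalComplex.quasiIso (A ⥤ AddCommGrpCat.{u}) (.up ℤ)).op.IsInvertedBy
      (preLPointwiseHom φ M) := by
  intro F F' f hf
  have hf' : QuasiIso f.unop := hf
  have h : QuasiIso ((pointwiseHom φ M).map ((kProjectiveResolution A).map f.unop).op) :=
    quasiIso_pointwiseHom_map _ _ _
  exact (inferInstance : IsIso (DerivedCategory.Q.map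
    ((pointwiseHom φ M).map ((kProjectiveResolution A).map f.unop).op)))

/-- The derived functor of `pointwiseHom φ M`, given by `F ↦ (b ↦ Hom•(P(F)_{φ b}, M_b))`. -/
noncomputable def LPointwiseHom (φ : B ⥤ Aᵒᵖ) (M : CochainComplex (B ⥤ AddCommGrpCat.{u}) ℤ) :
    (DerivedCategory (A ⥤ AddCommGrpCat.{u}))ᵒᵖ ⥤ DerivedCategory (B ⥤ AddCommGrpCat.{u}) :=
  Localization.lift (preLPointwiseHom φ M) (preLPointwiseHom_isInvertedBy φ M)
    DerivedCategory.Q.op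

end PointwiseHom

/-! ### Abelian data -/

/-- Abelian data on a space `X`: functors from `X`, preordered by
`p ≤ q ↔ closure {p} ⊆ closure {q}`, to abelian groups. -/
abbrev AbelianData (X : Type u) [TopologicalSpace X] := Specialization X ⥤ AddCommGrpCat.{u}

/-! ### The dual space -/

/-- The dual space of `X`: the same points, and the open subsets are the closed subsets of `X`. -/
def DualSpace (X : Type u) := X

namespace DualSpace

/-- The point `p̂` of the dual space corresponding to `p`. -/
def toDual {X : Type u} : X ≃ DualSpace X := Equiv.refl _

/-- The point `p` corresponding to a point `p̂` of the dual space. -/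
def ofDual {X : Type u} : DualSpace X ≃ X := Equiv.refl _

variable {X : Type u} [TopologicalSpace X] [Finite X]

instance : Finite (DualSpace X) := inferInstanceAs (Finite X)

instance : TopologicalSpace (DualSpace X) where
  IsOpen s := IsClosed (toDual ⁻¹' s)
  isOpen_univ := isClosed_univ
  isOpen_inter s t hs ht := hs.inter ht
  isOpen_sUnion S hS := by
    rw [Set.preimage_sUnion]
    exact isClosed_iUnion₂ hS

lemma isOpen_iff {s : Set (DualSpace X)} : IsOpen s ↔ IsClosed (toDual ⁻¹' s) := Iff.rfl

lemma isClosed_iff {s : Set (DualSpace X)} : IsClosed s ↔ IsOpen (toDual ⁻¹' s) := by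
  rw [← isOpen_compl_iff, isOpen_iff, Set.preimage_compl, isClosed_compl_iff]

lemma specializes_iff {p q : X} : toDual p ⤳ toDual q ↔ q ⤳ p := by
  rw [specializes_iff_forall_closed, specializes_iff_forall_open]
  constructor
  · intro h s hs hp
    exact h (ofDual ⁻¹' s) (isClosed_iff.2 hs) hp
  · intro h s hs hp
    exact h (toDual ⁻¹' s) (isClosed_iff.1 hs) hp

variable (X)

/-- The contravariant functor `p̂ ↦ p` from `X̂` to `X`. -/
def toOp : Specialization (DualSpace X) ⥤ (Specialization X)ᵒᵖ where
  obj p := op (Specialization.toEquiv (ofDual (Specialization.ofEquiv p)))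
  map {p q} f := (homOfLE (specializes_iff.1 (show _ from leOfHom f))).op

/-- The contravariant functor `p ↦ p̂` from `X` to `X̂`. -/
def opTo : Specialization X ⥤ (Specialization (DualSpace X))ᵒᵖ where
  obj p := op (Specialization.toEquiv (toDual (Specialization.ofEquiv p)))
  map {p q} f := (homOfLE (specializes_iff.2 (show _ from leOfHom f))).op

end DualSpace

/-! ### Locally constant data -/

section LocallyConstant

variable {X : Type u} [TopologicalSpace X]

/-- The restriction of abelian data to a subspace. -/
noncomputable def restrict (F : AbelianData X) (U : Set X) : AbelianData U :=
  (Specialization.map (⟨Subtype.val, continuous_subtype_val⟩ : C(U, X))).monotone.functor ⋙ F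

/-- Abelian data are locally constant if for any `p`, their restriction to the smallest open
neighbourhood `U_p` of `p` is isomorphic to constant data. -/
def IsLocallyConstant (F : AbelianData X) : Prop :=
  ∀ p : X, ∃ G : AddCommGrpCat.{u},
    Nonempty (restrict F (nhdsKer {p}) ≅ (Functor.const _).obj G)

lemma IsLocallyConstant.isIso_map {F : AbelianData X} (hF : IsLocallyConstant F)
    {p q : Specialization X} (f : p ⟶ q) : IsIso (F.map f) := by
  obtain ⟨G, ⟨e⟩⟩ := hF (Specialization.ofEquiv p)
  have hpq : Specialization.ofEquiv q ⤳ Specialization.ofEquiv p := leOfHom f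
  let p' : nhdsKer {Specialization.ofEquiv p} :=
    ⟨Specialization.ofEquiv p, mem_nhdsKer_singleton.2 specializes_rfl⟩
  let q' : nhdsKer {Specialization.ofEquiv p} :=
    ⟨Specialization.ofEquiv q, mem_nhdsKer_singleton.2 hpq⟩
  have h : q' ⤳ p' := Topology.IsInducing.subtypeVal.specializes_iff.1 hpq
  let f' : Specialization.toEquiv p' ⟶ Specialization.toEquiv q' :=
    homOfLE (Specialization.toEquiv_le_toEquiv.2 h)
  have : IsIso ((restrict F (nhdsKer {Specialization.ofEquiv p})).map f') := by
    rw [NatIso.isIso_map_iff e]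
    dsimp
    infer_instance
  exact this

/-- Locally constant data `F` on `X`, considered as data on the dual space: the transition map
`F_p ⟶ F_q` for `p̂ ≤ q̂` is the inverse of the transition map `F_q ⟶ F_p`. -/
noncomputable def IsLocallyConstant.dual [Finite X] {F : AbelianData X}
    (hF : IsLocallyConstant F) : AbelianData (DualSpace X) where
  obj p := F.obj ((DualSpace.toOp X).obj p).unop
  map f := have := hF.isIso_map ((DualSpace.toOp X).map f).unop
    inv (F.map ((DualSpace.toOp X).map f).unop)
  map_id p := by simp
  map_comp f g := by
    have := hF.isIso_map ((DualSpace.toOp X).map f).unop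
    have := hF.isIso_map ((DualSpace.toOp X).map g).unop
    simp

/-- The complex on the dual space given by a complex of locally constant data. -/
noncomputable def dualComplex [Finite X] (L : CochainComplex (AbelianData X) ℤ)
    (hL : ∀ n, IsLocallyConstant (L.X n)) : CochainComplex (AbelianData (DualSpace X)) ℤ where
  X n := (hL n).dual
  d i j :=
    { app p := (L.d i j).app _
      naturality p q f := by
        have := (hL i).isIso_map ((DualSpace.toOp X).map f).unop
        have := (hL j).isIso_map ((DualSpace.toOp X).map f).unop
        simp [IsLocallyConstant.dual] }
  shape i j h := by ext p : 2; exact congr_app (L.shape i j h) _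
  d_comp_d' i j k _ _ := by ext p : 2; exact congr_app (L.d_comp_d i j k) _

/-- The functor `F ↦ L𝒟Hom•(F, L)` from `D(X)` to `D(X̂)`, where
`𝒟Hom•(F, L)_p̂ = Hom•(F_p, L_p)`. -/
noncomputable def LDHom [Finite X] (L : CochainComplex (AbelianData X) ℤ)
    (hL : ∀ n, IsLocallyConstant (L.X n)) :
    (DerivedCategory (AbelianData X))ᵒᵖ ⥤ DerivedCategory (AbelianData (DualSpace X)) :=
  LPointwiseHom (DualSpace.toOp X) (dualComplex L hL)

/-- The functor `T ↦ L𝒟Hom•(T, L)` from `D(X̂)` to `D(X)`, where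
`𝒟Hom•(T, L)_p = Hom•(T_p̂, L_p)`. -/
noncomputable def LDHomDual [Finite X] (L : CochainComplex (AbelianData X) ℤ) :
    (DerivedCategory (AbelianData (DualSpace X)))ᵒᵖ ⥤ DerivedCategory (AbelianData X) :=
  LPointwiseHom (DualSpace.opTo X) L

end LocallyConstant

end FiniteSpace

/-! The isomorphism already exists before deriving, as a natural isomorphism of complexes
$\mathrm{Hom}^\bullet(T,\mathcal D\mathrm{Hom}^\bullet(F,\mathcal
L))\cong\mathrm{Hom}^\bullet(F,\mathcal D\mathrm{Hom}^\bullet(T,\mathcal L))$. A degree $n$ cochain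
on the left is the same as a family of biadditive maps $T_{\widehat p}\times F_p\to\mathcal L_p$ of
degree $n$ (`pairing`, `cochain_ext`, `cochainMk`) satisfying, for $\widehat p\le\widehat q$, $z(r
t,f)=r\,z(t,r f)$, where $t\in T_{\widehat p}$ and $f\in F_q$ (`pairing_naturality`). The map $r$ in
front of $z$ is the inverse of $\mathcal L_q\to\mathcal L_p$, so moving it to the other side gives
exactly the condition for a cochain from $F$ to the dual of $T$. This is where local constancy
enters, through the field `map_ε_map`.

Exchanging the arguments, with the Koszul sign $(-1)^{ip}$ in bidegree $(i,p)$, commutes with the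
differentials: this is the sign computation in `δ_swap`, based on the formula `pairing_δ`.
Exchanging twice is the identity, and the exchange is natural in both variables
(`swapHom_naturality`).

To derive, replace $T$ and $F$ by $P(T)$ and $P(F)$. Since $\mathbb R\mathrm{Hom}^\bullet$ resolves
only its first argument, both sides are then computed by these complexes with no further resolution.
An isomorphism between bifunctors of complexes that invert quasi-isomorphisms descends to the
localizations (`PairingDuality.RHomIso`). -/

namespace FiniteSpace

section Swap

open CochainComplex CochainComplex.HomComplex

variable {A B : Type u} [Category.{u} A] [Category.{u} B]

/-! ### Cochains into a pointwise Hom complex as biadditive pairings -/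

section Pairing

variable {φ : B ⥤ Aᵒᵖ} {M : CochainComplex (B ⥤ AddCommGrpCat.{u}) ℤ}
  {T T' : CochainComplex (B ⥤ AddCommGrpCat.{u}) ℤ}
  {F F' : CochainComplex (A ⥤ AddCommGrpCat.{u}) ℤ} {n : ℤ}

/-- The cochain `F_{φ b} → M_b` underlying an element of `pointwiseHom φ M`. -/
def toCochain {m : ℤ} {b : B} (x : (((pointwiseHom φ M).obj (op F)).X m).obj b) :
    Cochain (((values A).obj F).obj (φ.obj b).unop) (((values B).obj M).obj b) m := x

/-- Transition maps of the pointwise complex are two-sided compositions: $F$ enters contravariantly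
through `φ`, and $M$ covariantly. -/
lemma toCochain_map_v {m : ℤ} {b b' : B} (x : (((pointwiseHom φ M).obj (op F)).X m).obj b)
    (g : b ⟶ b') (i q : ℤ) (h : i + m = q) (f : (F.X i).obj (φ.obj b').unop) :
    (toCochain ((((pointwiseHom φ M).obj (op F)).X m).map g x)).v i q h f =
      (M.X q).map g ((toCochain x).v i q h ((F.X i).map (φ.map g).unop f)) := by
  have e : toCochain ((((pointwiseHom φ M).obj (op F)).X m).map g x) =
      (Cochain.ofHom (((values A).obj F).map (φ.map g).unop)).comp
        ((toCochain x).comp (Cochain.ofHom (((values B).obj M).map g)) (add_zero _))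
        (zero_add _) := rfl
  rw [e, Cochain.zero_cochain_comp_v, Cochain.comp_zero_cochain_v, Cochain.ofHom_v,
    Cochain.ofHom_v]
  rfl

/-- The biadditive maps `T_b × F_{φ b} → M_b` attached to a cochain from `T` to
`pointwiseHom φ M` evaluated at `F`. -/
noncomputable def pairing (z : Cochain T ((pointwiseHom φ M).obj (op F)) n) (b : B) (p i q : ℤ)
    (h : p + i + n = q) (t : (T.X p).obj b) (f : (F.X i).obj (φ.obj b).unop) : (M.X q).obj b :=
  (toCochain ((z.v p (p + n) rfl).app b t)).v i q (by lia) f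

/-- The definition of `pairing` fixes the intermediate degree to be literally `p + n`; here it may
be any `m` equal to it, as happens after applying a differential. -/
lemma pairing_eq (z : Cochain T ((pointwiseHom φ M).obj (op F)) n) (b : B) (p i q m : ℤ)
    (h : p + i + n = q) (hm : p + n = m) (t : (T.X p).obj b) (f : (F.X i).obj (φ.obj b).unop) :
    (toCochain ((z.v p m hm).app b t)).v i q (by lia) f = pairing z b p i q h t f := by
  subst hm
  rfl

/-- A cochain into the pointwise complex is a cochain of cochains, hence determined by its values on
pairs of elements. All later identities between cochains are checked this way. -/
lemma cochain_ext {z z' : Cochain T ((pointwiseHom φ M).obj (op F)) n}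
    (h : ∀ b p i q h t f, pairing z b p i q h t f = pairing z' b p i q h t f) : z = z' := by
  ext p m hm b t
  refine Cochain.ext (F := ((values A).obj F).obj (φ.obj b).unop)
    (G := ((values B).obj M).obj b) _ _ (fun i q hiq ↦ ?_)
  ext f
  exact (pairing_eq z b p i q m (by lia) hm t f).trans ((h b p i q (by lia) t f).trans
    (pairing_eq z' b p i q m (by lia) hm t f).symm)

lemma pairing_add_left (z : Cochain T ((pointwiseHom φ M).obj (op F)) n) (b : B) (p i q : ℤ)
    (h : p + i + n = q) (t t' : (T.X p).obj b) (f : (F.X i).obj (φ.obj b).unop) :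
    pairing z b p i q h (t + t') f = pairing z b p i q h t f + pairing z b p i q h t' f := by
  dsimp only [pairing]
  rw [map_add]
  rfl

lemma pairing_add_right (z : Cochain T ((pointwiseHom φ M).obj (op F)) n) (b : B) (p i q : ℤ)
    (h : p + i + n = q) (t : (T.X p).obj b) (f f' : (F.X i).obj (φ.obj b).unop) :
    pairing z b p i q h t (f + f') = pairing z b p i q h t f + pairing z b p i q h t f' :=
  map_add _ _ _

lemma pairing_add (z z' : Cochain T ((pointwiseHom φ M).obj (op F)) n) (b : B) (p i q : ℤ)
    (h : p + i + n = q) (t : (T.X p).obj b) (f : (F.X i).obj (φ.obj b).unop) :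
    pairing (z + z') b p i q h t f = pairing z b p i q h t f + pairing z' b p i q h t f := rfl

/-- This is naturality of the components of `z` in `b`, unwound through the mixed variance of the
target: `t` lives over the source of `g`, while `f` lives over the image of its target. It is the
only compatibility that a family of pairings must satisfy. -/
lemma pairing_naturality (z : Cochain T ((pointwiseHom φ M).obj (op F)) n) {b b' : B} (g : b ⟶ b')
    (p i q : ℤ) (h : p + i + n = q) (t : (T.X p).obj b) (f : (F.X i).obj (φ.obj b').unop) :
    pairing z b' p i q h ((T.X p).map g t) f =
      (M.X q).map g (pairing z b p i q h t ((F.X i).map (φ.map g).unop f)) := by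
  have e : (z.v p (p + n) rfl).app b' ((T.X p).map g t) =
      (((pointwiseHom φ M).obj (op F)).X (p + n)).map g ((z.v p (p + n) rfl).app b t) :=
    ConcreteCategory.congr_hom ((z.v p (p + n) rfl).naturality g) t
  dsimp only [pairing]
  rw [e]
  exact toCochain_map_v _ _ _ _ _ _

lemma pairing_precomp (x : T' ⟶ T) (z : Cochain T ((pointwiseHom φ M).obj (op F)) n)
    (b : B) (p i q : ℤ) (h : p + i + n = q) (t : (T'.X p).obj b)
    (f : (F.X i).obj (φ.obj b).unop) :
    pairing ((Cochain.ofHom x).comp z (zero_add n)) b p i q h t f =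
      pairing z b p i q h ((x.f p).app b t) f := by
  dsimp only [pairing]
  rw [Cochain.zero_cochain_comp_v, Cochain.ofHom_v]
  rfl

lemma pairing_postcomp (y : F' ⟶ F) (z : Cochain T ((pointwiseHom φ M).obj (op F)) n)
    (b : B) (p i q : ℤ) (h : p + i + n = q) (t : (T.X p).obj b)
    (f : (F'.X i).obj (φ.obj b).unop) :
    pairing (z.comp (Cochain.ofHom ((pointwiseHom φ M).map y.op)) (add_zero n)) b p i q h t f =
      pairing z b p i q h t ((y.f i).app _ f) := by
  dsimp only [pairing]
  rw [Cochain.comp_zero_cochain_v, Cochain.ofHom_v]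
  have e' : toCochain ((z.v p (p + n) rfl ≫ ((pointwiseHom φ M).map y.op).f (p + n)).app b t) =
      (Cochain.ofHom (((values A).map y).app (φ.obj b).unop)).comp
        ((toCochain ((z.v p (p + n) rfl).app b t)).comp
          (Cochain.ofHom (𝟙 (((values B).obj M).obj b))) (add_zero _)) (zero_add _) := rfl
  rw [e', Cochain.zero_cochain_comp_v, Cochain.comp_zero_cochain_v, Cochain.ofHom_v,
    Cochain.ofHom_v]
  rfl

/-- Two Hom differentials are nested. The outer one, in degree `n`, contributes the sign of `n + 1`
on the differential of `T`; the inner one acts on a cochain of degree `p + n` and contributes the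
sign of `p + n + 1` on the differential of `F`. -/
lemma pairing_δ (z : Cochain T ((pointwiseHom φ M).obj (op F)) n)
    (b : B) (p i q : ℤ) (h : p + i + (n + 1) = q) (t : (T.X p).obj b)
    (f : (F.X i).obj (φ.obj b).unop) :
    pairing (δ n (n + 1) z) b p i q h t f =
      (M.d (q - 1) q).app b (pairing z b p i (q - 1) (by lia) t f) +
        (p + n + 1).negOnePow • pairing z b p (i + 1) q (by lia) t ((F.d i (i + 1)).app _ f) +
        (n + 1).negOnePow • pairing z b (p + 1) i q (by lia) ((T.d p (p + 1)).app b t) f := by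
  rw [← pairing_eq (δ n (n + 1) z) b p i q (p + n + 1) h (by lia), δ_v n (n + 1) rfl z p (p + n + 1)
    (by lia) (p + n) (p + 1) (by lia) rfl]
  -- The differential of the pointwise complex is by definition `δ` on cochains over each `b`.
  have e : toCochain ((z.v p (p + n) rfl ≫
      ((pointwiseHom φ M).obj (op F)).d (p + n) (p + n + 1) + (n + 1).negOnePow •
        T.d p (p + 1) ≫ z.v (p + 1) (p + n + 1) (by lia)).app b t) =
      δ (p + n) (p + n + 1) (toCochain ((z.v p (p + n) rfl).app b t)) +
        (n + 1).negOnePow • toCochain ((z.v (p + 1) (p + n + 1) (by lia)).app b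
          ((T.d p (p + 1)).app b t)) := by
    rcases Int.even_or_odd (n + 1) with hn | hn
    · rw [Int.negOnePow_even _ hn, one_smul, one_smul]
      rfl
    · rw [Int.negOnePow_odd _ hn]
      simp only [Units.neg_smul, one_smul]
      rfl
  rw [e, Cochain.add_v, Cochain.units_smul_v, δ_v (p + n) (p + n + 1) rfl _ i q (by lia) (q - 1)
    (i + 1) (by lia) rfl]
  -- Once the parities are fixed, each sign is an explicit `1` or `-1`, and its actions on morphisms
  -- and on elements agree by unfolding.
  rcases Int.even_or_odd (n + 1) with hn | hn
  · rw [Int.negOnePow_even _ hn]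
    rcases Int.even_or_odd (p + n + 1) with hp | hp
    · rw [Int.negOnePow_even _ hp]
      simp only [one_smul]
      rw [← pairing_eq z b (p + 1) i q (p + n + 1) (by lia) (by lia)]
      rfl
    · rw [Int.negOnePow_odd _ hp]
      simp only [Units.neg_smul, one_smul]
      rw [← pairing_eq z b (p + 1) i q (p + n + 1) (by lia) (by lia)]
      rfl
  · rw [Int.negOnePow_odd _ hn]
    rcases Int.even_or_odd (p + n + 1) with hp | hp
    · rw [Int.negOnePow_even _ hp]
      simp only [Units.neg_smul, one_smul]
      rw [← pairing_eq z b (p + 1) i q (p + n + 1) (by lia) (by lia)]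
      rfl
    · rw [Int.negOnePow_odd _ hp]
      simp only [Units.neg_smul, one_smul]
      rw [← pairing_eq z b (p + 1) i q (p + n + 1) (by lia) (by lia)]
      rfl

/-- The cochain `F_{φ b} → M_b` with given components. -/
noncomputable def cochainOfComponents {m : ℤ} {b : B}
    (β : ∀ (i q : ℤ) (_ : i + m = q), (F.X i).obj (φ.obj b).unop →+ (M.X q).obj b) :
    (((pointwiseHom φ M).obj (op F)).X m).obj b :=
  (Cochain.mk fun i q hq ↦ AddCommGrpCat.ofHom (β i q hq) :
    Cochain (((values A).obj F).obj (φ.obj b).unop) (((values B).obj M).obj b) m)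

/-- Construct a cochain from its pairing. -/
noncomputable def cochainMk
    (β : ∀ (b : B) (p i q : ℤ) (_ : p + i + n = q), (T.X p).obj b → (F.X i).obj (φ.obj b).unop →
      (M.X q).obj b)
    (hl : ∀ b p i q h t t' f, β b p i q h (t + t') f = β b p i q h t f + β b p i q h t' f)
    (hr : ∀ b p i q h t f f', β b p i q h t (f + f') = β b p i q h t f + β b p i q h t f')
    (hβ : ∀ {b b' : B} (g : b ⟶ b') p i q h t f, β b' p i q h ((T.X p).map g t) f =
      (M.X q).map g (β b p i q h t ((F.X i).map (φ.map g).unop f))) :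
    Cochain T ((pointwiseHom φ M).obj (op F)) n :=
  Cochain.mk fun p m hm ↦
    { app b := AddCommGrpCat.ofHom (AddMonoidHom.mk'
        (fun t ↦ cochainOfComponents fun i q hq ↦ AddMonoidHom.mk'
          (fun f ↦ β b p i q (by lia) t f) (hr _ _ _ _ _ _))
        (fun t t' ↦ by
          refine Cochain.ext (F := ((values A).obj F).obj (φ.obj b).unop)
            (G := ((values B).obj M).obj b) _ _ (fun i q hiq ↦ ?_)
          ext f
          exact hl b p i q (by lia) t t' f))
      naturality b b' g := by
        ext t
        refine Cochain.ext (F := ((values A).obj F).obj (φ.obj b').unop)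
          (G := ((values B).obj M).obj b') _ _ (fun i q hiq ↦ ?_)
        ext f
        -- By `toCochain_map_v`, the hypothesis `hβ` is exactly naturality in `b`.
        refine (hβ g p i q (by lia) t f).trans ?_
        exact (toCochain_map_v (cochainOfComponents fun i q hq ↦ AddMonoidHom.mk'
          (fun f ↦ β b p i q (by lia) t f) (hr _ _ _ _ _ _)) g i q hiq f).symm }

end Pairing

lemma map_units_smul_ab {G H : AddCommGrpCat.{u}} (f : G ⟶ H) (s : ℤˣ) (x : G) :
    f (s • x) = s • f x := by
  rw [Units.smul_def, Units.smul_def, map_zsmul]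

/-! ### Exchange of the two variables of a pairing -/

section

variable {φ : B ⥤ Aᵒᵖ} {ψ : A ⥤ Bᵒᵖ} {M : CochainComplex (B ⥤ AddCommGrpCat.{u}) ℤ}
  {N : CochainComplex (A ⥤ AddCommGrpCat.{u}) ℤ}

variable (φ ψ M N) in
/-- The data required in order to compare pairings with values in `M` and in `N`. -/
structure PairingComparison where
  /-- The unit. -/
  η : 𝟭 A ⟶ ψ ⋙ φ.leftOp
  /-- The comparison of the coefficients. -/
  ε (a : A) : ((values B).obj M).obj (ψ.obj a).unop ⟶ ((values A).obj N).obj a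
  -- Going back along `ψ g` in `M`, comparing, and going forward along `g` in `N` cancels out. For
  -- locally constant coefficients this says that a transition map composed with its inverse is the
  -- identity.
  map_ε_map {a a' : A} (g : a ⟶ a') :
    ((values B).obj M).map (ψ.map g).unop ≫ ε a ≫ ((values A).obj N).map g = ε a'

namespace PairingComparison

variable (c : PairingComparison φ ψ M N)
  {T T' : CochainComplex (B ⥤ AddCommGrpCat.{u}) ℤ}
  {F F' : CochainComplex (A ⥤ AddCommGrpCat.{u}) ℤ} {n : ℤ}

/-- The comparison of the coefficients, in degree `q`. -/
noncomputable def εX (a : A) (q : ℤ) : (M.X q).obj (ψ.obj a).unop ⟶ (N.X q).obj a :=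
  (c.ε a).f q

/-- The unit, as a transition map of `F`. -/
noncomputable def ηMap (F : A ⥤ AddCommGrpCat.{u}) (a : A) :
    F.obj a ⟶ F.obj (φ.obj (ψ.obj a).unop).unop :=
  F.map (c.η.app a)

lemma map_εX_map {a a' : A} (g : a ⟶ a') (q : ℤ) (x : (M.X q).obj (ψ.obj a').unop) :
    (N.X q).map g (c.εX a q ((M.X q).map (ψ.map g).unop x)) = c.εX a' q x :=
  ConcreteCategory.congr_hom (HomologicalComplex.congr_hom (c.map_ε_map g) q) x

lemma εX_d (a : A) (q q' : ℤ) (x : (M.X q).obj (ψ.obj a).unop) :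
    (N.d q q').app a (c.εX a q x) = c.εX a q' ((M.d q q').app _ x) :=
  ConcreteCategory.congr_hom ((c.ε a).comm q q') x

lemma ηMap_naturality {F F' : A ⥤ AddCommGrpCat.{u}} (y : F ⟶ F') (a : A) (f : F.obj a) :
    c.ηMap F' a (y.app a f) = y.app _ (c.ηMap F a f) :=
  (ConcreteCategory.congr_hom (y.naturality (c.η.app a)) f).symm

lemma ηMap_map (F : A ⥤ AddCommGrpCat.{u}) {a a' : A} (g : a ⟶ a') (f : F.obj a) :
    c.ηMap F a' (F.map g f) = F.map (φ.map (ψ.map g).unop).unop (c.ηMap F a f) := by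
  have h := F.congr_map (c.η.naturality g)
  rw [F.map_comp, F.map_comp] at h
  exact ConcreteCategory.congr_hom h f

/-- Exchange of the two variables of the pairing attached to a cochain. -/
noncomputable def swap (z : Cochain T ((pointwiseHom φ M).obj (op F)) n) :
    Cochain F ((pointwiseHom ψ N).obj (op T)) n :=
  cochainMk (φ := ψ)
    -- The Koszul sign for moving `f`, of degree `i`, past `t`, of degree `p`; it makes the exchange
    -- commute with `δ`.
    (fun a i p q h f t ↦ (i * p).negOnePow •
      c.εX a q (pairing z (ψ.obj a).unop p i q (by lia) t (c.ηMap (F.X i) a f)))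
    (fun a i p q h f f' t ↦ by rw [map_add, pairing_add_right, map_add, smul_add])
    (fun a i p q h f t t' ↦ by rw [pairing_add_left, map_add, smul_add])
    -- Rewrite the comparison at `a'` through the one at `a` by `map_εX_map`; the transition map of
    -- `M` so produced is absorbed by naturality of the pairing along `ψ g`.
    (fun {a a'} g i p q h f t ↦ by
      rw [map_units_smul_ab, ηMap_map, ← c.map_εX_map g, ← pairing_naturality])

lemma pairing_swap (z : Cochain T ((pointwiseHom φ M).obj (op F)) n) (a : A) (i p q : ℤ)
    (h : i + p + n = q) (f : (F.X i).obj a) (t : (T.X p).obj (ψ.obj a).unop) :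
    pairing (c.swap z) a i p q h f t = (i * p).negOnePow •
      c.εX a q (pairing z (ψ.obj a).unop p i q (by lia) t (c.ηMap (F.X i) a f)) := rfl

lemma swap_add (z z' : Cochain T ((pointwiseHom φ M).obj (op F)) n) :
    c.swap (z + z') = c.swap z + c.swap z' := by
  refine cochain_ext fun a i p q h f t ↦ ?_
  rw [pairing_add, pairing_swap, pairing_swap, pairing_swap, pairing_add, map_add, smul_add]

/-- Both sides consist of the same three terms of `pairing_δ`, with the differentials of `T` and `F`
trading places; only the signs need comparison. -/
lemma δ_swap (z : Cochain T ((pointwiseHom φ M).obj (op F)) n) :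
    δ n (n + 1) (c.swap z) = c.swap (δ n (n + 1) z) := by
  refine cochain_ext fun a i p q h f t ↦ ?_
  rw [pairing_δ, pairing_swap, pairing_swap, pairing_swap, pairing_swap, pairing_δ,
    map_units_smul_ab, εX_d, map_add, map_add, map_units_smul_ab, map_units_smul_ab, smul_add,
    smul_add, smul_smul, smul_smul, smul_smul, smul_smul, ηMap_naturality, add_right_comm,
    ← Int.negOnePow_add, ← Int.negOnePow_add, ← Int.negOnePow_add, ← Int.negOnePow_add]
  have e₁ : (n + 1 + (i + 1) * p).negOnePow = (i * p + (p + n + 1)).negOnePow := by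
    congr 1
    ring
  -- The two exponents differ by `2 * i`.
  have e₂ : (i + n + 1 + i * (p + 1)).negOnePow = (i * p + (n + 1)).negOnePow := by
    rw [Int.negOnePow_eq_iff]
    exact ⟨i, by ring⟩
  rw [e₁, e₂]

lemma swap_precomp (x : T' ⟶ T) (z : Cochain T ((pointwiseHom φ M).obj (op F)) n) :
    c.swap ((Cochain.ofHom x).comp z (zero_add n)) =
      (c.swap z).comp (Cochain.ofHom ((pointwiseHom ψ N).map x.op)) (add_zero n) := by
  refine cochain_ext fun a i p q h f t ↦ ?_
  rw [pairing_postcomp, pairing_swap, pairing_swap, pairing_precomp]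

lemma swap_postcomp (y : F' ⟶ F) (z : Cochain T ((pointwiseHom φ M).obj (op F)) n) :
    c.swap (z.comp (Cochain.ofHom ((pointwiseHom φ M).map y.op)) (add_zero n)) =
      (Cochain.ofHom y).comp (c.swap z) (zero_add n) := by
  refine cochain_ext fun a i p q h f t ↦ ?_
  rw [pairing_precomp, pairing_swap, pairing_swap, pairing_postcomp, ηMap_naturality]

variable (T F) in
/-- Exchange of variables, as a morphism of complexes. -/
noncomputable def swapHom : HomComplex T ((pointwiseHom φ M).obj (op F)) ⟶
    HomComplex F ((pointwiseHom ψ N).obj (op T)) where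
  f n := AddCommGrpCat.ofHom (AddMonoidHom.mk' c.swap c.swap_add)
  comm' i j hij := by
    obtain rfl : i + 1 = j := hij
    ext z
    exact c.δ_swap z

/-- Joint naturality in both variables; taking one of the morphisms to be an identity gives
naturality in each separately. -/
lemma swapHom_naturality (x : T' ⟶ T) (y : F' ⟶ F) :
    homComplexMap x ((pointwiseHom φ M).map y.op) ≫ c.swapHom T' F' =
      c.swapHom T F ≫ homComplexMap y ((pointwiseHom ψ N).map x.op) := by
  ext n z
  refine (c.swap_precomp _ _).trans ((congrArg (fun w : Cochain _ _ n ↦ w.comp _ (add_zero n))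
    (c.swap_postcomp y z)).trans ?_)
  exact Cochain.comp_assoc_of_third_is_zero_cochain _ _ _ _

end PairingComparison

end

/-! ### Mutually inverse exchanges and the isomorphism of Hom complexes -/

variable (φ : B ⥤ Aᵒᵖ) (ψ : A ⥤ Bᵒᵖ) (M : CochainComplex (B ⥤ AddCommGrpCat.{u}) ℤ)
  (N : CochainComplex (A ⥤ AddCommGrpCat.{u}) ℤ)

/-- Two comparisons which are inverse to each other. -/
structure PairingDuality where
  /-- The comparison from pairings with values in `M` to pairings with values in `N`. -/
  left : PairingComparison φ ψ M N
  /-- The comparison from pairings with values in `N` to pairings with values in `M`. -/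
  right : PairingComparison ψ φ N M
  right_swap_left_swap {T : CochainComplex (B ⥤ AddCommGrpCat.{u}) ℤ}
    {F : CochainComplex (A ⥤ AddCommGrpCat.{u}) ℤ} {n : ℤ}
    (z : Cochain T ((pointwiseHom φ M).obj (op F)) n) : right.swap (left.swap z) = z
  left_swap_right_swap {T : CochainComplex (B ⥤ AddCommGrpCat.{u}) ℤ}
    {F : CochainComplex (A ⥤ AddCommGrpCat.{u}) ℤ} {n : ℤ}
    (z : Cochain F ((pointwiseHom ψ N).obj (op T)) n) : left.swap (right.swap z) = z

variable {φ ψ M N}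

namespace PairingDuality

variable (c : PairingDuality φ ψ M N)

/-- Exchange of variables, as an isomorphism of complexes. -/
noncomputable def swapIso (T : CochainComplex (B ⥤ AddCommGrpCat.{u}) ℤ)
    (F : CochainComplex (A ⥤ AddCommGrpCat.{u}) ℤ) :
    HomComplex T ((pointwiseHom φ M).obj (op F)) ≅
      HomComplex F ((pointwiseHom ψ N).obj (op T)) where
  hom := c.left.swapHom T F
  inv := c.right.swapHom F T
  hom_inv_id := by ext n z; exact c.right_swap_left_swap z
  inv_hom_id := by ext n z; exact c.left_swap_right_swap z

/-- The isomorphism `Hom•(P(T), Hom•(P(F)_φ, M)) ≅ Hom•(P(F), Hom•(P(T)_ψ, N))`. -/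
noncomputable def preRHomIso :
    preRHom B ⋙ (Functor.whiskeringLeft _ _ _).obj ((kProjectiveResolution A).op ⋙ pointwiseHom φ M) ≅
      ((kProjectiveResolution B).op ⋙ pointwiseHom ψ N) ⋙ (preRHom A).flip :=
  NatIso.ofComponents (fun T ↦ NatIso.ofComponents (fun F ↦
      (DerivedCategory.Q (C := AddCommGrpCat.{u})).mapIso (c.swapIso ((kProjectiveResolution B).obj T.unop)
        ((kProjectiveResolution A).obj F.unop)))
      -- Both composites are images under `Q` of chain maps, so it suffices to apply
      -- `swapHom_naturality` at the level of complexes.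
      (fun {F F'} y ↦ by
        refine ((DerivedCategory.Q (C := AddCommGrpCat.{u})).map_comp _ _).symm.trans (Eq.trans ?_
          ((DerivedCategory.Q (C := AddCommGrpCat.{u})).map_comp _ _))
        refine congrArg (DerivedCategory.Q (C := AddCommGrpCat.{u})).map
          ((c.left.swapHom_naturality (𝟙 _) ((kProjectiveResolution A).map y.unop)).trans ?_)
        rw [op_id, CategoryTheory.Functor.map_id]
        rfl))
    (fun {T T'} x ↦ by
      ext F
      refine ((DerivedCategory.Q (C := AddCommGrpCat.{u})).map_comp _ _).symm.trans (Eq.trans ?_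
        ((DerivedCategory.Q (C := AddCommGrpCat.{u})).map_comp _ _))
      refine congrArg (DerivedCategory.Q (C := AddCommGrpCat.{u})).map (Eq.trans ?_
        (c.left.swapHom_naturality ((kProjectiveResolution B).map x.unop) (𝟙 _)))
      rw [op_id, CategoryTheory.Functor.map_id]
      rfl)

end PairingDuality

end Swap

/-! ### Descent to derived categories -/

section Derived

variable {A B : Type u} [Category.{u} A] [Category.{u} B]

noncomputable instance : Localization.Lifting₂ DerivedCategory.Q.op DerivedCategory.Q
    (HomologicalComplex.quasiIso (B ⥤ AddCommGrpCat.{u}) (.up ℤ)).op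
    (HomologicalComplex.quasiIso (B ⥤ AddCommGrpCat.{u}) (.up ℤ)) (preRHom B) (RHom B) :=
  inferInstanceAs (Localization.Lifting₂ _ _ _ _ _
    (Localization.lift₂ (preRHom B) preRHom_isInvertedBy _ _))

/-- `RHom(T, LPointwiseHom(F))` is induced by the underived bifunctor on resolutions. -/
noncomputable instance RHom_lifting₂ (φ : B ⥤ Aᵒᵖ) (M : CochainComplex (B ⥤ AddCommGrpCat.{u}) ℤ) :
    Localization.Lifting₂ DerivedCategory.Q.op DerivedCategory.Q.op
      (HomologicalComplex.quasiIso (B ⥤ AddCommGrpCat.{u}) (.up ℤ)).op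
      (HomologicalComplex.quasiIso (A ⥤ AddCommGrpCat.{u}) (.up ℤ)).op
      (preRHom B ⋙ (Functor.whiskeringLeft _ _ _).obj
        ((kProjectiveResolution A).op ⋙ pointwiseHom φ M))
      (RHom B ⋙ (Functor.whiskeringLeft _ _ _).obj (LPointwiseHom φ M)) where
  iso :=
    let e : DerivedCategory.Q.op ⋙ LPointwiseHom φ M ≅ preLPointwiseHom φ M :=
      Localization.fac _ (preLPointwiseHom_isInvertedBy φ M) _
    let e' := Localization.Lifting₂.iso DerivedCategory.Q.op DerivedCategory.Q
      (HomologicalComplex.quasiIso (B ⥤ AddCommGrpCat.{u}) (.up ℤ)).op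
      (HomologicalComplex.quasiIso (B ⥤ AddCommGrpCat.{u}) (.up ℤ)) (preRHom B) (RHom B)
    -- First `e` replaces the derived pointwise Hom by the image under `Q` of the complex built from
    -- `P(F)`; the second argument of `RHom` then comes from a complex, and `e'` applies with a
    -- resolution of the first argument only.
    Functor.isoWhiskerLeft (DerivedCategory.Q.op ⋙ RHom B)
      ((Functor.whiskeringLeft _ _ _).mapIso e) ≪≫
      Functor.isoWhiskerRight e' ((Functor.whiskeringLeft _ _ _).obj
        ((kProjectiveResolution A).op ⋙ pointwiseHom φ M))

variable {φ : B ⥤ Aᵒᵖ} {ψ : A ⥤ Bᵒᵖ} {M : CochainComplex (B ⥤ AddCommGrpCat.{u}) ℤ}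
  {N : CochainComplex (A ⥤ AddCommGrpCat.{u}) ℤ}

/-- The isomorphism `RHom(T, Hom•(P(F)_φ, M)) ≅ RHom(F, Hom•(P(T)_ψ, N))`. -/
noncomputable def PairingDuality.RHomIso (c : PairingDuality φ ψ M N) :
    RHom B ⋙ (Functor.whiskeringLeft _ _ _).obj (LPointwiseHom φ M) ≅
      LPointwiseHom ψ N ⋙ (RHom A).flip :=
  -- The right-hand side is the left-hand construction with the roles of `A` and `B` exchanged, read
  -- with its two variables flipped.
  letI : Localization.Lifting₂ DerivedCategory.Q.op DerivedCategory.Q.op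
      (HomologicalComplex.quasiIso (B ⥤ AddCommGrpCat.{u}) (.up ℤ)).op
      (HomologicalComplex.quasiIso (A ⥤ AddCommGrpCat.{u}) (.up ℤ)).op
      (((kProjectiveResolution B).op ⋙ pointwiseHom ψ N) ⋙ (preRHom A).flip)
      (LPointwiseHom ψ N ⋙ (RHom A).flip) :=
    Localization.Lifting₂.flip DerivedCategory.Q.op DerivedCategory.Q.op _ _
      (preRHom A ⋙ (Functor.whiskeringLeft _ _ _).obj
        ((kProjectiveResolution B).op ⋙ pointwiseHom ψ N))
      (RHom A ⋙ (Functor.whiskeringLeft _ _ _).obj (LPointwiseHom ψ N))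
  Localization.lift₂NatIso DerivedCategory.Q.op DerivedCategory.Q.op
    (HomologicalComplex.quasiIso (B ⥤ AddCommGrpCat.{u}) (.up ℤ)).op
    (HomologicalComplex.quasiIso (A ⥤ AddCommGrpCat.{u}) (.up ℤ)).op _ _ _ _ c.preRHomIso

end Derived

/-! ### Locally constant coefficients on a space and its dual -/

section LocallyConstant

variable {X : Type u} [TopologicalSpace X] [Finite X] (L : CochainComplex (AbelianData X) ℤ)
  (hL : ∀ n, IsLocallyConstant (L.X n))

/-- Exchange of variables in pairings with values in locally constant data, from `X̂` to `X`. -/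
noncomputable def pairingComparison :
    PairingComparison (DualSpace.toOp X) (DualSpace.opTo X) (dualComplex L hL) L where
  -- Passing to the dual point twice returns the same point, so the unit is the identity.
  η := { app p := 𝟙 p }
  ε p := 𝟙 (((values (Specialization X)).obj L).obj p)
  map_ε_map {p q} g := by
    ext n : 1
    have := (hL n).isIso_map g
    -- The transition map of the dual complex is the inverse of the one of `L`; it exists because
    -- `L` is locally constant.
    exact IsIso.inv_hom_id ((L.X n).map g)

/-- Exchange of variables in pairings with values in locally constant data, from `X` to `X̂`. -/
noncomputable def pairingComparisonDual :
    PairingComparison (DualSpace.opTo X) (DualSpace.toOp X) L (dualComplex L hL) where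
  η := { app p := 𝟙 p }
  ε p := 𝟙 (((values (Specialization X)).obj L).obj ((DualSpace.toOp X).obj p).unop)
  map_ε_map {p q} g := by
    ext n : 1
    have := (hL n).isIso_map ((DualSpace.toOp X).map g).unop
    exact IsIso.hom_inv_id ((L.X n).map ((DualSpace.toOp X).map g).unop)

/-- The duality on pairings with values in locally constant data. -/
noncomputable def pairingDuality :
    PairingDuality (DualSpace.toOp X) (DualSpace.opTo X) (dualComplex L hL) L where
  left := pairingComparison L hL
  right := pairingComparisonDual L hL
  right_swap_left_swap {T F n} z := by
    refine cochain_ext fun p i j q h t f ↦ ?_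
    -- The two Koszul signs have equal exponents `j * i` and `i * j`, so their product is `1`. What
    -- remains are transition maps along identities, coming from the two units.
    rw [PairingComparison.pairing_swap, PairingComparison.pairing_swap, map_units_smul_ab, smul_smul,
      mul_comm j i, Int.units_mul_self, one_smul]
    exact congr_arg₂ (pairing z p i j q h) (ConcreteCategory.congr_hom ((T.X i).map_id p) t)
      (ConcreteCategory.congr_hom ((F.X j).map_id _) f)
  left_swap_right_swap {T F n} z := by
    refine cochain_ext fun p i j q h t f ↦ ?_
    rw [PairingComparison.pairing_swap, PairingComparison.pairing_swap, map_units_smul_ab, smul_smul,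
      mul_comm j i, Int.units_mul_self, one_smul]
    exact congr_arg₂ (pairing z p i j q h) (ConcreteCategory.congr_hom ((F.X i).map_id p) t)
      (ConcreteCategory.congr_hom ((T.X j).map_id _) f)

end LocallyConstant

end FiniteSpace

/-- Both sides are functors `D(X̂)ᵒᵖ ⥤ D(X)ᵒᵖ ⥤ D(Ab)`: the left-hand side is
`T ↦ F ↦ RHom(T, L𝒟Hom(F, L))` and the right-hand side is `T ↦ F ↦ RHom(F, L𝒟Hom(T, L))`. -/
theorem mainTheorem9 {X : Type u} [TopologicalSpace X] [Finite X]
    (L : CochainComplex (FiniteSpace.AbelianData X) ℤ)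
    (hL : ∀ n, FiniteSpace.IsLocallyConstant (L.X n)) :
    Nonempty
      (FiniteSpace.RHom (Specialization (FiniteSpace.DualSpace X)) ⋙
          (Functor.whiskeringLeft _ _ _).obj (FiniteSpace.LDHom L hL) ≅
        FiniteSpace.LDHomDual L ⋙ (FiniteSpace.RHom (Specialization X)).flip) :=
  ⟨(FiniteSpace.pairingDuality L hL).RHomIso⟩
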